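/- Let $d\ge 1$, let $\|\cdot\|$ and $\langle\cdot,\cdot\rangle$ be the Euclidean norm and inner product on $\mathbb{R}^d$, and let $\mathbb{S}^{d-1}$ be the unit sphere. A Lévy measure is a positive Borel measure $\nu$ on $\mathbb{R}^d$ with $\nu(\{0\})=0$ and $\int(1\wedge\|u\|^2)\,\nu(du)<\infty$. A random vector $X$ is called self-decomposable with parameter $b\in\mathbb{R}^d$, $\Sigma=0$ (no Gaussian part) and Lévy measure $\nu$ if $$\mathbb{E}e^{i\langle\xi,X\rangle}=\exp\Big(i\langle b,\xi\rangle+\int_{\mathbb{R}^d}\big(e^{i\langle\xi,u\rangle}-1-i\langle\xi,u\rangle\mathbf{1}_{\|u\|\le1}\big)\nu(du)\Big),\qquad \xi\in\mathbb{R}^d,$$ and $\nu$ admits a polar decomposition $\nu(du)=\mathbf{1}_{(0,\infty)}(r)\mathbf{1}_{\mathbb{S}^{d-1}}(x)\frac{k_x(r)}{r}\,dr\,\sigma(dx)$ with $\sigma$ a finite positive measure on $\mathbb{S}^{d-1}$ and $k_x(r)$ nonnegative, measurable in $x$, and nonincreasing and right-continuous in $r\in(0,\infty)$. Theorem. Let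 $X$ be a random vector in $\mathbb{R}^d$, let $b\in\mathbb{R}^d$, and let $\nu$ be a Lévy measure with $\int_{\|u\|\le1}\|u\|\,\nu(du)<\infty$ and with polar decomposition $$\nu(du)=\mathbf{1}_{(0,\infty)}(r)\mathbf{1}_{\mathbb{S}^{d-1}}(x)\frac{k_x(r)}{r}\,dr\,\sigma(dx),$$ where $\sigma$ is a finite positive measure on $\mathbb{S}^{d-1}$ and $k_x(r)$ is nonnegative, continuous and nonincreasing in $r\in(0,\infty)$, continuous in $x\in\mathbb{S}^{d-1}$, and such that $$\lim_{\varepsilon\to0^+}\varepsilon k_x(\varepsilon)=0,\quad \lim_{R\to\infty}k_x(R)=0\quad(x\in\mathbb{S}^{d-1}),\qquad \int_0^\infty(1\wedge r)\max_{x\in\mathbb{S}^{d-1}}k_x(r)\,\frac{dr}{r}<\infty.$$ Assume moreover that, whenever $x_n\to x$ in $\mathbb{S}^{d-1}$ and $a>0$, $$\lim_{n\to\infty}\lim_{R\to\infty}V_a^R(k_{x_n}-k_x)=0,$$ where $V_a^R(g)$ denotes the total variation of $g$ on $[a,R]$. Let $\tilde\nu$ be the positive measure $$\tilde\nu(du)=\mathbf{1}_{(0,\infty)}(r)\mathbf{1}_{\mathbb{S}^{d-1}}(x)\,(-dk_x(r))\,\sigma(dx),$$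 where $-dk_x$ is the Lebesgue–Stieltjes measure on $(0,\infty)$ giving mass $k_x(r_1)-k_x(r_2)$ to $(r_1,r_2]$, and assume $\int_{\mathbb{R}^d}(1\wedge\|u\|)\,\tilde\nu(du)<\infty$. Put $b_0=b-\int_{\|u\|\le1}u\,\nu(du)$. Then $$\mathbb{E}\langle X,\nabla f(X)\rangle=\mathbb{E}\langle b_0,\nabla f(X)\rangle+\mathbb{E}\int_{\mathbb{R}^d}\big(f(X+u)-f(X)\big)\,\tilde\nu(du)$$ holds for all real-valued Schwartz functions $f$ on $\mathbb{R}^d$ if and only if $X$ is self-decomposable with parameter $b$, $\Sigma=0$ and Lévy measure $\nu$. -/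

import Mathlib

open MeasureTheory Set Filter Topology
open scoped ENNReal SchwartzMap Gradient RealInnerProductSpace

namespace SelfDec

/-- The unit sphere of `ℝ^d`. -/
abbrev USphere (d : ℕ) : Type := Metric.sphere (0 : EuclideanSpace ℝ (Fin d)) 1

/-- A Lévy measure on `ℝ^d`: no mass at the origin, and `∫ min(1, ‖u‖²) ν(du) < ∞`. -/
structure IsLevyMeasure {d : ℕ} (ν : Measure (EuclideanSpace ℝ (Fin d))) : Prop where
  zero : ν {0} = 0
  lintegral_lt_top : ∫⁻ u, ENNReal.ofReal (min 1 (‖u‖ ^ 2)) ∂ν < ∞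

/-- The Lévy–Khintchine exponent
`i⟨b, ξ⟩ - ⟨ξ, Sξ⟩ / 2 + ∫ (e^{i⟨ξ, u⟩} - 1 - i⟨ξ, u⟩ 1_{‖u‖ ≤ 1}) ν(du)`. -/
noncomputable def levyKhintchineExponent {d : ℕ} (b : EuclideanSpace ℝ (Fin d))
    (S : Matrix (Fin d) (Fin d) ℝ) (ν : Measure (EuclideanSpace ℝ (Fin d)))
    (ξ : EuclideanSpace ℝ (Fin d)) : ℂ :=
  Complex.I * (⟪b, ξ⟫ : ℝ) - (1 / 2 : ℂ) * (⟪ξ, S.toEuclideanLin ξ⟫ : ℝ)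
    + ∫ u, (Complex.exp (Complex.I * (⟪ξ, u⟫ : ℝ)) - 1
        - (Metric.closedBall (0 : EuclideanSpace ℝ (Fin d)) 1).indicator
            (fun v => Complex.I * ((⟪ξ, v⟫ : ℝ) : ℂ)) u) ∂ν

/-- The law `μ` is infinitely divisible with triplet `(b, S, ν)`. -/
structure IsInfinitelyDivisible {d : ℕ} (μ : Measure (EuclideanSpace ℝ (Fin d)))
    (b : EuclideanSpace ℝ (Fin d)) (S : Matrix (Fin d) (Fin d) ℝ)
    (ν : Measure (EuclideanSpace ℝ (Fin d))) : Prop where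
  posSemidef : S.PosSemidef
  isLevyMeasure : IsLevyMeasure ν
  charFun_eq : ∀ ξ, charFun μ ξ = Complex.exp (levyKhintchineExponent b S ν ξ)

/-- The measure `1_{(0,∞)}(r) 1_{sphere}(x) ρ_x(dr) σ(dx)` on `ℝ^d`: a Borel set `B` gets the mass
`∫ ρ_x {r | r x ∈ B} σ(dx)`, for every measurable family `ρ` of measures on `(0,∞)`; see
`polarMeasure_negStieltjes_apply` and `polarMeasure_radialDensity_apply` for the families in use. -/
noncomputable def polarMeasure {d : ℕ} (σ : Measure (USphere d)) (ρ : USphere d → Measure ℝ) :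
    Measure (EuclideanSpace ℝ (Fin d)) :=
  σ.bind fun x => (ρ x).map fun r : ℝ => r • (x : EuclideanSpace ℝ (Fin d))

/-- The measure `1_{(0,∞)}(r) (g r / r) dr`. -/
noncomputable def radialDensity (g : ℝ → ℝ) : Measure ℝ :=
  (volume.restrict (Ioi 0)).withDensity fun r => ENNReal.ofReal (g r / r)

theorem monotone_neg_comp_exp {g : ℝ → ℝ} (hg : AntitoneOn g (Ioi 0)) :
    Monotone fun t : ℝ => -g (Real.exp t) := fun _ _ h =>
  neg_le_neg (hg (Real.exp_pos _) (Real.exp_pos _) (Real.exp_le_exp.2 h))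

/-- The Lebesgue–Stieltjes measure `-dg` on `(0,∞)` of a function `g` decreasing on `(0,∞)`
(and possibly unbounded at `0`): the image under `exp : ℝ → (0,∞)` of the Lebesgue–Stieltjes
measure on `ℝ` of the increasing function `t ↦ -g (exp t)`. It gives mass `g a - g b` to `(a, b]`
and mass `0` to `(-∞, 0]`, see `negStieltjes_Ioc` and `negStieltjes_Iic_zero`. -/
noncomputable def negStieltjes (g : ℝ → ℝ) (hg : AntitoneOn g (Ioi 0)) : Measure ℝ :=
  ((monotone_neg_comp_exp hg).stieltjesFunction.measure).map Real.exp

theorem negStieltjes_Iic_zero (g : ℝ → ℝ) (hg : AntitoneOn g (Ioi 0)) :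
    negStieltjes g hg (Iic 0) = 0 := by
  rw [negStieltjes, Measure.map_apply Real.measurable_exp measurableSet_Iic]
  have h : Real.exp ⁻¹' Iic 0 = ∅ := by
    ext t
    simp [Real.exp_pos t]
  rw [h, measure_empty]

theorem negStieltjes_Ioc (g : ℝ → ℝ) (hg : AntitoneOn g (Ioi 0)) (hc : ContinuousOn g (Ioi 0))
    {a b : ℝ} (ha : 0 < a) (hb : 0 < b) :
    negStieltjes g hg (Ioc a b) = ENNReal.ofReal (g a - g b) := by
  have hcont : Continuous fun t : ℝ => -g (Real.exp t) :=
    (hc.comp_continuous Real.continuous_exp fun t => Real.exp_pos t).neg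
  have hr : ∀ t, (monotone_neg_comp_exp hg).stieltjesFunction t = -g (Real.exp t) := fun t =>
    (monotone_neg_comp_exp hg).continuousWithinAt_Ioi_iff_rightLim_eq.1
      hcont.continuousAt.continuousWithinAt
  have h : Real.exp ⁻¹' Ioc a b = Ioc (Real.log a) (Real.log b) := by
    ext t
    simp [Real.log_lt_iff_lt_exp ha, Real.le_log_iff_exp_le hb]
  rw [negStieltjes, Measure.map_apply Real.measurable_exp measurableSet_Ioc, h,
    StieltjesFunction.measure_Ioc, hr, hr, Real.exp_log ha, Real.exp_log hb]
  congr 1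
  ring

theorem measurable_map_smul {d : ℕ} {ρ : USphere d → Measure ℝ}
    (hρ : ∀ a b : ℝ, 0 < a → 0 < b → Measurable fun x => ρ x (Ioc a b))
    (hfin : ∀ x, ∀ a b : ℝ, 0 < a → 0 < b → ρ x (Ioc a b) < ∞)
    (h0 : ∀ x, ρ x (Iic 0) = 0) :
    Measurable fun x => (ρ x).map fun r : ℝ => r • (x : EuclideanSpace ℝ (Fin d)) := by
  let I : ℕ → Set ℝ := fun n => Ioc (1 / ((n : ℝ) + 1)) ((n : ℝ) + 1)
  have hpos : ∀ n : ℕ, (0 : ℝ) < (n : ℝ) + 1 := fun n => by positivity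
  have hfinI : ∀ n x, IsFiniteMeasure ((ρ x).restrict (I n)) := fun n x =>
    ⟨by rw [Measure.restrict_apply_univ]; exact hfin x _ _ (one_div_pos.2 (hpos n)) (hpos n)⟩
  have h1 : ∀ n, Measurable fun x => (ρ x).restrict (I n) := fun n => by
    have := hfinI n
    refine Measurable.measure_of_isPiSystem (S := {s | ∃ a b : ℝ, a < b ∧ Ioc a b = s})
      (borel_eq_generateFrom_Ioc ℝ ▸ BorelSpace.measurable_eq) ?_ ?_ ?_
    · exact isPiSystem_Ioc (id : ℝ → ℝ) id
    · rintro s ⟨a, b, -, rfl⟩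
      simp only [Measure.restrict_apply measurableSet_Ioc, I, Ioc_inter_Ioc]
      by_cases hb : 0 < min b ((n : ℝ) + 1)
      · exact hρ _ _ (lt_of_lt_of_le (one_div_pos.2 (hpos n)) (le_max_right _ _)) hb
      · rw [Ioc_eq_empty]
        · simp
        · intro h
          exact hb (((one_div_pos.2 (hpos n)).trans_le (le_max_right _ _)).trans h)
    · simp only [Measure.restrict_apply_univ]
      exact hρ _ _ (one_div_pos.2 (hpos n)) (hpos n)
  have h2 : ∀ n, Measurable fun x => ((ρ x).restrict (I n)).map (Prod.mk x) := fun n => by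
    have := hfinI n
    have : ∀ x, IsFiniteMeasure (((ρ x).restrict (I n)).map (Prod.mk x)) := fun x => inferInstance
    refine Measurable.measure_of_isPiSystem generateFrom_prod.symm isPiSystem_prod ?_ ?_
    · rintro _ ⟨A, hA, B, hB, rfl⟩
      replace hA : MeasurableSet A := hA
      replace hB : MeasurableSet B := hB
      have : (fun x => ((ρ x).restrict (I n)).map (Prod.mk x) (A ×ˢ B))
          = A.indicator fun x => (ρ x).restrict (I n) B := by
        ext x
        rw [Measure.map_apply measurable_prodMk_left (hA.prod hB)]
        by_cases hx : x ∈ A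
        · simp [hx]
        · simp [hx]
      rw [this]
      exact ((Measure.measurable_coe hB).comp (h1 n)).indicator hA
    · simp only [Measure.map_apply measurable_prodMk_left MeasurableSet.univ, preimage_univ]
      exact (Measure.measurable_coe MeasurableSet.univ).comp (h1 n)
  refine Measure.measurable_of_measurable_coe _ fun B hB => ?_
  have hsm : Measurable fun p : USphere d × ℝ => p.2 • (p.1 : EuclideanSpace ℝ (Fin d)) := by
    fun_prop
  have hU : ⋃ n, I n = Ioi 0 := by
    ext r
    simp only [mem_iUnion, I, mem_Ioc, mem_Ioi]
    constructor
    · rintro ⟨n, h, -⟩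
      exact (one_div_pos.2 (hpos n)).trans h
    · intro hr
      obtain ⟨n, hn⟩ := exists_nat_gt (max r (1 / r))
      refine ⟨n, ?_, ((le_max_left _ _).trans hn.le).trans (by linarith)⟩
      rw [one_div_lt (hpos n) hr]
      exact ((le_max_right _ _).trans_lt hn).trans (by linarith)
  have hmono : Monotone I := fun m n hmn => by
    have : (m : ℝ) ≤ n := by exact_mod_cast hmn
    exact Ioc_subset_Ioc (one_div_le_one_div_of_le (hpos m) (by linarith)) (by linarith)
  have key : (fun x => ((ρ x).map fun r : ℝ => r • (x : EuclideanSpace ℝ (Fin d))) B)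
      = fun x => ⨆ n, ((ρ x).restrict (I n)).map (Prod.mk x)
          ((fun p : USphere d × ℝ => p.2 • (p.1 : EuclideanSpace ℝ (Fin d))) ⁻¹' B) := by
    ext x
    have hsx : Measurable fun r : ℝ => r • (x : EuclideanSpace ℝ (Fin d)) := by fun_prop
    rw [Measure.map_apply hsx hB]
    simp only [Measure.map_apply measurable_prodMk_left (hsm hB)]
    have e : ∀ n, (ρ x).restrict (I n) (Prod.mk x ⁻¹'
        ((fun p : USphere d × ℝ => p.2 • (p.1 : EuclideanSpace ℝ (Fin d))) ⁻¹' B))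
        = ρ x ((fun r : ℝ => r • (x : EuclideanSpace ℝ (Fin d))) ⁻¹' B ∩ I n) := fun n =>
      Measure.restrict_apply (hsx hB)
    simp only [e]
    rw [← Monotone.measure_iUnion (fun m n h => inter_subset_inter_right _ (hmono h)),
      ← inter_iUnion, hU, ← compl_Iic, ← sdiff_eq, measure_sdiff_null (h0 x)]
  rw [key]
  exact Measurable.iSup fun n => (Measure.measurable_coe (hsm hB)).comp (h2 n)

theorem polarMeasure_negStieltjes_apply {d : ℕ} (σ : Measure (USphere d))
    {k : USphere d → ℝ → ℝ} (ha : ∀ x, AntitoneOn (k x) (Ioi 0))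
    (hc : ∀ x, ContinuousOn (k x) (Ioi 0)) (hm : ∀ r > 0, Measurable fun x => k x r)
    {B : Set (EuclideanSpace ℝ (Fin d))} (hB : MeasurableSet B) :
    polarMeasure σ (fun x => negStieltjes (k x) (ha x)) B
      = ∫⁻ x, negStieltjes (k x) (ha x) {r | r • (x : EuclideanSpace ℝ (Fin d)) ∈ B} ∂σ := by
  rw [polarMeasure, Measure.bind_apply hB]
  · refine lintegral_congr fun x => ?_
    have hsx : Measurable fun r : ℝ => r • (x : EuclideanSpace ℝ (Fin d)) := by fun_prop
    rw [Measure.map_apply hsx hB]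
    rfl
  · refine (measurable_map_smul (fun a b h h' => ?_) (fun x a b h h' => ?_)
      fun x => negStieltjes_Iic_zero _ _).aemeasurable
    · simp only [negStieltjes_Ioc _ (ha _) (hc _) h h']
      exact ((hm a h).sub (hm b h')).ennreal_ofReal
    · rw [negStieltjes_Ioc _ (ha _) (hc _) h h']
      exact ENNReal.ofReal_lt_top

theorem polarMeasure_radialDensity_apply {d : ℕ} (σ : Measure (USphere d))
    {k : USphere d → ℝ → ℝ} (ha : ∀ x, AntitoneOn (k x) (Ioi 0))
    (hc : ∀ x, ContinuousOn (k x) (Ioi 0)) (hm : ∀ r > 0, Measurable fun x => k x r)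
    {B : Set (EuclideanSpace ℝ (Fin d))} (hB : MeasurableSet B) :
    polarMeasure σ (fun x => radialDensity (k x)) B
      = ∫⁻ x, radialDensity (k x) {r | r • (x : EuclideanSpace ℝ (Fin d)) ∈ B} ∂σ := by
  have hI : ∀ x, ∀ a b : ℝ, 0 < a → radialDensity (k x) (Ioc a b)
      = ∫⁻ r in Ioc a b, ENNReal.ofReal (k x r / r) := fun x a b h => by
    rw [radialDensity, withDensity_apply _ measurableSet_Ioc,
      Measure.restrict_restrict measurableSet_Ioc, inter_eq_left.2]
    exact fun r hr => h.trans hr.1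
  rw [polarMeasure, Measure.bind_apply hB]
  · refine lintegral_congr fun x => ?_
    have hsx : Measurable fun r : ℝ => r • (x : EuclideanSpace ℝ (Fin d)) := by fun_prop
    rw [Measure.map_apply hsx hB]
    rfl
  · refine (measurable_map_smul (fun a b h h' => ?_) (fun x a b h h' => ?_)
      fun x => ?_).aemeasurable
    · have hu : Measurable (Function.uncurry fun (t : ℝ) (x : USphere d) => k x (Real.exp t)) :=
        measurable_uncurry_of_continuous_of_measurable
          (fun x => (hc x).comp_continuous Real.continuous_exp fun t => Real.exp_pos t)
          (fun t => hm _ (Real.exp_pos t))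
      have hv : Measurable fun p : USphere d × ℝ =>
          ENNReal.ofReal (k p.1 (Real.exp (Real.log p.2)) / p.2) :=
        ((hu.comp ((Real.measurable_log.comp measurable_snd).prodMk measurable_fst)).div
          measurable_snd).ennreal_ofReal
      have he : (fun x => radialDensity (k x) (Ioc a b)) = fun x => ∫⁻ r in Ioc a b,
          ENNReal.ofReal (k x (Real.exp (Real.log r)) / r) := by
        ext x
        rw [hI x a b h]
        refine setLIntegral_congr_fun measurableSet_Ioc fun r hr => ?_
        simp only [Real.exp_log (h.trans hr.1)]
      rw [he]
      exact hv.lintegral_prod_right'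
    · rw [hI x a b h]
      refine (setLIntegral_mono measurable_const (g := fun _ => ENNReal.ofReal (|k x a| / a))
        fun r hr => ENNReal.ofReal_le_ofReal ?_).trans_lt ?_
      · have hr0 : 0 < r := h.trans hr.1
        exact div_le_div₀ (abs_nonneg _) ((ha x h hr0 hr.1.le).trans (le_abs_self _)) h hr.1.le
      · simp [ENNReal.mul_lt_top]
    · rw [radialDensity, withDensity_apply _ measurableSet_Iic,
        Measure.restrict_restrict measurableSet_Iic]
      simp [Iic_inter_Ioi]

/-- The law `μ` is self-decomposable without Gaussian part, with parameter `b` and Lévy measure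
`ν`: it is infinitely divisible with triplet `(b, 0, ν)` and `ν` has a polar decomposition
`(k_x(r) / r) dr σ(dx)` with `σ` a finite measure on the sphere and `k_x(r)` nonnegative, measurable
in `x`, decreasing and right-continuous in `r`. -/
structure IsSelfDecomposable {d : ℕ} (μ : Measure (EuclideanSpace ℝ (Fin d)))
    (b : EuclideanSpace ℝ (Fin d)) (ν : Measure (EuclideanSpace ℝ (Fin d))) : Prop where
  isInfinitelyDivisible : IsInfinitelyDivisible μ b 0 ν
  exists_polar : ∃ (σ : Measure (USphere d)) (k : USphere d → ℝ → ℝ), IsFiniteMeasure σ ∧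
    (∀ x, ∀ r > 0, 0 ≤ k x r) ∧
    (∀ x, AntitoneOn (k x) (Ioi 0)) ∧
    (∀ x, ∀ r > 0, ContinuousWithinAt (k x) (Ici r) r) ∧
    (∀ r > 0, Measurable fun x => k x r) ∧
    ν = polarMeasure σ fun x => radialDensity (k x)

end SelfDec

namespace SelfDec

/-! ### Jump exponents and the Stein functionals on the Fourier side. -/

section Analysis

set_option linter.unusedSectionVars false

open scoped FourierTransform LineDeriv ContDiff
open Complex (I)

variable {V : Type*} [NormedAddCommGroup V] [InnerProductSpace ℝ V] [MeasurableSpace V]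

/-! The Stein identity is the weak form of a linear differential equation for the characteristic
function `ψ` of `X` along rays. Write a Schwartz function as `f = 𝓕 g`. Its drift and jump terms
then integrate to `∫ g(ξ) ψ(cξ) S(cξ) dξ`, where `c = -2π` and `S(ξ) = i⟨b₀, ξ⟩ + ∫ (e^{i⟨u, ξ⟩} -
1) ν'(du)` is `steinSymbol` (`stein_rhs_fourier`). The term with `⟨X, ∇f(X)⟩` is the derivative at
`y = 0` of `E f(e^y X) = ∫ g(ξ) ψ(e^y cξ) dξ`. So the identity says, weakly in `ξ`, that `d/dy ψ(e^y
ξ) = ψ(e^y ξ) S(e^y ξ)`.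

Since `ψ` and `S` are continuous, the integrated equation holds pointwise
(`SteinIdentity.charFun_sub`). If `Ψ` is a primitive of `S` along dilations, then `ψ e^{-Ψ}` is
constant on each ray, and its limit at the origin is 1, so `ψ = e^Ψ`. Conversely, `e^Ψ` solves the
equation, and integrating against `g` returns the identity (`steinIdentity_iff_charFun_eq`).

It remains to see that the Lévy–Khintchine exponent is such a primitive. Because `-dk_x` gives `[r,
∞)` the mass `k_x(r)`, the measure `ν` is the image of `ν' ⊗ dz` on `z ≤ 0` under `(u, z) ↦ e^z u`
(`polarMeasure_radialDensity_eq_map_prod`). Hence the jump exponent of `ν` at `e^y ξ` is the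
integral over `z ≤ y` of that of `ν'` at `e^z ξ` (`hasDerivAt_jumpExponent_exp_smul`). -/

theorem continuous_cexp_inner_mul_I (a : ℝ) :
    Continuous fun p : V × V => Complex.exp ((⟪p.1, a • p.2⟫ : ℝ) * I) := by
  fun_prop

theorem norm_cexp_inner_mul_I (x ξ : V) : ‖Complex.exp ((⟪x, ξ⟫ : ℝ) * I)‖ = 1 :=
  Complex.norm_exp_ofReal_mul_I _

/-- Large jumps use the trivial bound 2, small ones the Lipschitz bound. Growth only linear in `ξ`
lets a Schwartz factor absorb every symbol below. -/
theorem norm_cexp_sub_one_le (u ξ : V) :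
    ‖Complex.exp ((⟪u, ξ⟫ : ℝ) * I) - 1‖ ≤ (2 + ‖ξ‖) * min 1 ‖u‖ := by
  rcases le_total 1 ‖u‖ with h | h
  · rw [min_eq_left h]
    have := norm_sub_le (Complex.exp ((⟪u, ξ⟫ : ℝ) * I)) 1
    rw [norm_cexp_inner_mul_I, norm_one] at this
    linarith [norm_nonneg ξ]
  · rw [min_eq_right h, mul_comm (_ : ℂ) I]
    refine (Real.norm_exp_I_mul_ofReal_sub_one_le).trans ?_
    refine (norm_inner_le_norm u ξ).trans ?_
    nlinarith [norm_nonneg u]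

/-- The exponent `∫ (e^{i⟨u, ξ⟩} - 1) κ(du)` of a jump measure of finite variation. -/
noncomputable def jumpExponent (κ : Measure V) (ξ : V) : ℂ :=
  ∫ u, (Complex.exp ((⟪u, ξ⟫ : ℝ) * I) - 1) ∂κ

variable [BorelSpace V] [FiniteDimensional ℝ V] {κ μ : Measure V}

theorem integrable_cexp_sub_one (hκ : Integrable (fun u => min 1 ‖u‖) κ) (ξ : V) :
    Integrable (fun u => Complex.exp ((⟪u, ξ⟫ : ℝ) * I) - 1) κ := by
  refine (hκ.const_mul (2 + ‖ξ‖)).mono' ?_ (ae_of_all _ fun u => norm_cexp_sub_one_le u ξ)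
  exact Continuous.aestronglyMeasurable (by fun_prop)

theorem norm_jumpExponent_le (hκ : Integrable (fun u => min 1 ‖u‖) κ) (ξ : V) :
    ‖jumpExponent κ ξ‖ ≤ (2 + ‖ξ‖) * ∫ u, min 1 ‖u‖ ∂κ := by
  rw [← integral_const_mul]
  exact norm_integral_le_of_norm_le (hκ.const_mul _)
    (ae_of_all _ fun u => norm_cexp_sub_one_le u ξ)

theorem continuous_jumpExponent (hκ : Integrable (fun u => min 1 ‖u‖) κ) :
    Continuous (jumpExponent κ) := by
  refine continuous_iff_continuousAt.2 fun ξ₀ => ?_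
  refine continuousAt_of_dominated (bound := fun u => (2 + (‖ξ₀‖ + 1)) * min 1 ‖u‖)
    (Eventually.of_forall fun ξ => (integrable_cexp_sub_one hκ ξ).aestronglyMeasurable) ?_
    (hκ.const_mul _) (ae_of_all _ fun u => by fun_prop)
  filter_upwards [(continuous_norm (E := V)).continuousAt.eventually_le_const
    (lt_add_one ‖ξ₀‖)] with ξ hξ
  refine ae_of_all _ fun u => (norm_cexp_sub_one_le u ξ).trans ?_
  gcongr

theorem jumpExponent_zero (κ : Measure V) : jumpExponent κ 0 = 0 := by
  simp [jumpExponent]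

theorem integral_integral_mul_cexp [IsFiniteMeasure μ] {h : V → ℂ} (hh : Integrable h) (a : ℝ) :
    ∫ x, (∫ ξ, h ξ * Complex.exp ((⟪x, a • ξ⟫ : ℝ) * I)) ∂μ = ∫ ξ, h ξ * charFun μ (a • ξ) := by
  rw [integral_integral_swap]
  · simp only [integral_const_mul]
    rfl
  · refine Integrable.mul_bdd (c := 1) (hh.comp_snd μ)
      (continuous_cexp_inner_mul_I a).aestronglyMeasurable (ae_of_all _ fun p => ?_)
    exact (norm_cexp_inner_mul_I _ _).le

/-- The Fourier kernel is `e^{-2πi⟨x, ξ⟩}` while `charFun` uses `e^{i⟨x, ξ⟩}`; this is the origin of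
the factor `-(2 * π)` everywhere below. -/
theorem fourier_smul_apply (g : 𝓢(V, ℂ)) (s : ℝ) (x : V) :
    (𝓕 g : 𝓢(V, ℂ)) (s • x)
      = ∫ ξ, g ξ * Complex.exp ((⟪x, (s * -(2 * Real.pi)) • ξ⟫ : ℝ) * I) := by
  rw [SchwartzMap.fourier_coe, Real.fourier_eq']
  refine integral_congr_ae (ae_of_all _ fun ξ => ?_)
  simp only [smul_eq_mul, inner_smul_right, real_inner_comm x ξ]
  rw [mul_comm]
  congr 3
  push_cast
  ring

theorem hasTemperateGrowth_inner_left (v : V) :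
    (fun ξ : V => (⟪ξ, v⟫ : ℝ)).HasTemperateGrowth :=
  ((innerSL ℝ).flip v).hasTemperateGrowth

theorem fderiv_fourier_smul_apply (g : 𝓢(V, ℂ)) (s : ℝ) (x v : V) :
    fderiv ℝ (𝓕 g : 𝓢(V, ℂ)) (s • x) v
      = ∫ ξ, g ξ * ((⟪v, -(2 * Real.pi) • ξ⟫ : ℝ) * I)
          * Complex.exp ((⟪x, (s * -(2 * Real.pi)) • ξ⟫ : ℝ) * I) := by
  rw [← SchwartzMap.lineDerivOp_apply_eq_fderiv, SchwartzMap.lineDerivOp_fourier_eq,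
    fourier_smul_apply]
  refine integral_congr_ae (ae_of_all _ fun ξ => ?_)
  simp only [smul_apply, inner_smul_right, real_inner_comm ξ v,
    SchwartzMap.smulLeftCLM_apply_apply (hasTemperateGrowth_inner_left v)]
  simp
  ring

theorem integrable_mul_of_norm_le_linear (g : 𝓢(V, ℂ)) {h : V → ℂ} (hc : Continuous h) {A B : ℝ}
    (hb : ∀ ξ, ‖h ξ‖ ≤ A + B * ‖ξ‖) : Integrable fun ξ => g ξ * h ξ := by
  refine ((g.integrable.norm.const_mul A).add
    ((g.integrable_pow_mul volume 1).const_mul B)).mono'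
    (g.continuous.mul hc).aestronglyMeasurable (ae_of_all _ fun ξ => ?_)
  rw [norm_mul, Pi.add_apply, pow_one]
  nlinarith [mul_le_mul_of_nonneg_left (hb ξ) (norm_nonneg (g ξ))]

theorem norm_jumpExponent_smul_le (hκ : Integrable (fun u => min 1 ‖u‖) κ) (a : ℝ) (ξ : V) :
    ‖jumpExponent κ (a • ξ)‖
      ≤ 2 * (∫ u, min 1 ‖u‖ ∂κ) + (|a| * ∫ u, min 1 ‖u‖ ∂κ) * ‖ξ‖ := by
  refine (norm_jumpExponent_le hκ _).trans (le_of_eq ?_)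
  rw [norm_smul, Real.norm_eq_abs]
  ring

theorem integrable_mul_jumpExponent (hκ : Integrable (fun u => min 1 ‖u‖) κ) (g : 𝓢(V, ℂ))
    (a : ℝ) : Integrable fun ξ => g ξ * jumpExponent κ (a • ξ) :=
  integrable_mul_of_norm_le_linear g
    ((continuous_jumpExponent hκ).comp (continuous_const_smul a))
    (norm_jumpExponent_smul_le hκ a)

/-- Translation by `u` becomes multiplication by a character, so the jump operator is the Fourier
multiplier `jumpExponent`. -/
theorem integral_fourier_sub [SFinite κ] (hκ : Integrable (fun u => min 1 ‖u‖) κ)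
    (g : 𝓢(V, ℂ)) (s : ℝ) (x : V) :
    ∫ u, ((𝓕 g : 𝓢(V, ℂ)) (s • (x + u)) - (𝓕 g : 𝓢(V, ℂ)) (s • x)) ∂κ
      = ∫ ξ, g ξ * jumpExponent κ ((s * -(2 * Real.pi)) • ξ)
          * Complex.exp ((⟪x, (s * -(2 * Real.pi)) • ξ⟫ : ℝ) * I) := by
  set a := s * -(2 * Real.pi)
  have hint : ∀ y : V, Integrable fun ξ => g ξ * Complex.exp ((⟪y, a • ξ⟫ : ℝ) * I) := fun y =>
    integrable_mul_of_norm_le_linear g (A := 1) (B := 0) (by fun_prop)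
      fun ξ => by simp
  have h1 : ∀ u, (𝓕 g : 𝓢(V, ℂ)) (s • (x + u)) - (𝓕 g : 𝓢(V, ℂ)) (s • x)
      = ∫ ξ, g ξ * Complex.exp ((⟪x, a • ξ⟫ : ℝ) * I)
          * (Complex.exp ((⟪u, a • ξ⟫ : ℝ) * I) - 1) := fun u => by
    rw [fourier_smul_apply, fourier_smul_apply, ← integral_sub (hint _) (hint _)]
    refine integral_congr_ae (ae_of_all _ fun ξ => ?_)
    simp only [inner_add_left, Complex.ofReal_add, add_mul, Complex.exp_add]
    ring
  simp only [h1]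
  rw [integral_integral_swap]
  · refine integral_congr_ae (ae_of_all _ fun ξ => ?_)
    simp only [integral_const_mul]
    rw [jumpExponent]
    ring
  · have hb : Integrable (fun ξ => g ξ * ((2 + |a| * ‖ξ‖ : ℝ) : ℂ)) :=
      integrable_mul_of_norm_le_linear g (A := 2) (B := |a|) (by fun_prop) fun ξ => by
        rw [Complex.norm_real, Real.norm_of_nonneg (by positivity)]
    -- Fubini is justified by the product majorant `min 1 ‖u‖ * ‖g ξ‖ (2 + |a| ‖ξ‖)`.
    refine (hκ.mul_prod hb.norm).mono' ?_ (ae_of_all _ fun p => ?_)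
    · refine Continuous.aestronglyMeasurable ?_
      have := g.continuous
      simp only [Function.uncurry_def]
      fun_prop
    · simp only [Function.uncurry, norm_mul, norm_cexp_inner_mul_I, mul_one]
      rw [Complex.norm_real, Real.norm_of_nonneg (by positivity : 0 ≤ 2 + |a| * ‖p.2‖)]
      have := norm_cexp_sub_one_le p.1 (a • p.2)
      rw [norm_smul, Real.norm_eq_abs] at this
      nlinarith [mul_le_mul_of_nonneg_left this (norm_nonneg (g p.2))]

/-- The logarithmic derivative along dilations of the characteristic function
`exp (i⟨b, ξ⟩ + ∫ (e^{i⟨u, ξ⟩} - 1) ν(du))`, where `κ` is the radial derivative of `ν`. -/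
noncomputable def steinSymbol (b : V) (κ : Measure V) (ξ : V) : ℂ :=
  (⟪b, ξ⟫ : ℝ) * I + jumpExponent κ ξ

theorem continuous_steinSymbol (hκ : Integrable (fun u => min 1 ‖u‖) κ) (b : V) :
    Continuous (steinSymbol b κ) := by
  have := continuous_jumpExponent hκ
  unfold steinSymbol
  fun_prop

theorem norm_steinSymbol_smul_le (hκ : Integrable (fun u => min 1 ‖u‖) κ) (b : V) (a : ℝ) (ξ : V) :
    ‖steinSymbol b κ (a • ξ)‖
      ≤ 2 * (∫ u, min 1 ‖u‖ ∂κ) + (|a| * ((∫ u, min 1 ‖u‖ ∂κ) + ‖b‖)) * ‖ξ‖ := by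
  have h1 := norm_jumpExponent_smul_le hκ a ξ
  have h2 : ‖((⟪b, a • ξ⟫ : ℝ) : ℂ) * I‖ ≤ |a| * ‖b‖ * ‖ξ‖ := by
    rw [norm_mul, Complex.norm_I, mul_one, Complex.norm_real]
    refine (norm_inner_le_norm _ _).trans (le_of_eq ?_)
    rw [norm_smul, Real.norm_eq_abs]
    ring
  refine (norm_add_le _ _).trans ?_
  linarith

theorem continuous_charFun_mul_steinSymbol [IsProbabilityMeasure μ]
    (hκ : Integrable (fun u => min 1 ‖u‖) κ) (b : V) :
    Continuous fun ξ => charFun μ ξ * steinSymbol b κ ξ :=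
  continuous_charFun.mul (continuous_steinSymbol hκ b)

theorem norm_charFun_mul_steinSymbol_le [IsProbabilityMeasure μ]
    (hκ : Integrable (fun u => min 1 ‖u‖) κ) (b : V) (a : ℝ) (ξ : V) :
    ‖charFun μ (a • ξ) * steinSymbol b κ (a • ξ)‖
      ≤ 2 * (∫ u, min 1 ‖u‖ ∂κ) + (|a| * ((∫ u, min 1 ‖u‖ ∂κ) + ‖b‖)) * ‖ξ‖ := by
  rw [norm_mul]
  refine le_trans ?_ (norm_steinSymbol_smul_le hκ b a ξ)
  exact mul_le_of_le_one_left (norm_nonneg _) (norm_charFun_le_one _)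

theorem stein_rhs_fourier [IsProbabilityMeasure μ] [SFinite κ]
    (hκ : Integrable (fun u => min 1 ‖u‖) κ) (b : V) (g : 𝓢(V, ℂ)) (s : ℝ) :
    ∫ x, fderiv ℝ (𝓕 g : 𝓢(V, ℂ)) (s • x) (s • b) ∂μ
        + ∫ x, ∫ u, ((𝓕 g : 𝓢(V, ℂ)) (s • (x + u)) - (𝓕 g : 𝓢(V, ℂ)) (s • x)) ∂κ ∂μ
      = ∫ ξ, g ξ * (charFun μ ((s * -(2 * Real.pi)) • ξ)
          * steinSymbol b κ ((s * -(2 * Real.pi)) • ξ)) := by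
  set a := s * -(2 * Real.pi) with ha
  have hi1 : Integrable fun ξ => g ξ * ((⟪s • b, -(2 * Real.pi) • ξ⟫ : ℝ) * I) :=
    integrable_mul_of_norm_le_linear g (A := 0) (B := ‖s • b‖ * (2 * Real.pi)) (by fun_prop)
      fun ξ => by
        rw [norm_mul, Complex.norm_I, mul_one, Complex.norm_real]
        refine (norm_inner_le_norm _ _).trans (le_of_eq ?_)
        rw [norm_smul (-(2 * Real.pi)), norm_neg, Real.norm_of_nonneg (by positivity)]
        ring
  have hi2 := integrable_mul_jumpExponent hκ g a
  simp only [fderiv_fourier_smul_apply, integral_fourier_sub hκ, ← ha]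
  have hm : ∀ {h : V → ℂ}, Integrable h → Integrable fun ξ => h ξ * charFun μ (a • ξ) :=
    fun hh => hh.mul_bdd (c := 1)
      (continuous_charFun.comp (continuous_const_smul a)).aestronglyMeasurable
      (ae_of_all _ fun ξ => norm_charFun_le_one _)
  rw [integral_integral_mul_cexp hi1, integral_integral_mul_cexp hi2,
    ← integral_add (hm hi1) (hm hi2)]
  refine integral_congr_ae (ae_of_all _ fun ξ => ?_)
  simp only [steinSymbol, ha, inner_smul_left, inner_smul_right]
  simp
  ring

theorem stein_lhs_fourier [IsProbabilityMeasure μ] (g : 𝓢(V, ℂ)) (s : ℝ) :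
    ∫ x, (𝓕 g : 𝓢(V, ℂ)) (s • x) ∂μ
      = ∫ ξ, g ξ * charFun μ ((s * -(2 * Real.pi)) • ξ) := by
  simp only [fourier_smul_apply]
  exact integral_integral_mul_cexp g.integrable _

theorem exists_norm_fderiv_apply_self_le {W : Type*} [NormedAddCommGroup W] [NormedSpace ℝ W]
    (f : 𝓢(V, W)) :
    ∃ C, ∀ x, ‖fderiv ℝ f x x‖ ≤ C := by
  obtain ⟨C, -, hC⟩ := f.decay 1 1
  refine ⟨C, fun x => ((fderiv ℝ f x).le_opNorm x).trans ?_⟩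
  rw [mul_comm]
  simpa [norm_iteratedFDeriv_one] using hC x

theorem hasDerivAt_exp_smul (x : V) (y : ℝ) :
    HasDerivAt (fun y : ℝ => Real.exp y • x) (Real.exp y • x) y :=
  (Real.hasDerivAt_exp y).smul_const x

/-- No moment of `μ` is needed: `fderiv ℝ f z z` is bounded in `z` by Schwartz decay, which
dominates uniformly in `y`. -/
theorem hasDerivAt_integral_exp_smul [IsFiniteMeasure μ] (f : 𝓢(V, ℂ)) (y : ℝ) :
    HasDerivAt (fun y : ℝ => ∫ x, f (Real.exp y • x) ∂μ)
      (∫ x, fderiv ℝ f (Real.exp y • x) (Real.exp y • x) ∂μ) y := by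
  obtain ⟨C, hC⟩ := exists_norm_fderiv_apply_self_le f
  obtain ⟨B, hB⟩ : ∃ B, ∀ x, ‖f x‖ ≤ B := ⟨_, f.norm_le_seminorm ℝ⟩
  have hc := f.continuous
  have hc' : Continuous (fderiv ℝ f) := (f.smooth 1).continuous_fderiv one_ne_zero
  refine (hasDerivAt_integral_of_dominated_loc_of_deriv_le (s := univ) (bound := fun _ => C)
    (F' := fun y x => fderiv ℝ f (Real.exp y • x) (Real.exp y • x)) univ_mem
    (Eventually.of_forall fun y => Continuous.aestronglyMeasurable (by fun_prop)) ?_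
    (Continuous.aestronglyMeasurable (by fun_prop)) (ae_of_all _ fun x y _ => hC _)
    (integrable_const C) (ae_of_all _ fun x y _ => ?_)).2
  · exact Integrable.of_bound (Continuous.aestronglyMeasurable (by fun_prop)) B
      (ae_of_all _ fun x => hB _)
  · exact (f.differentiableAt.hasFDerivAt).comp_hasDerivAt y (hasDerivAt_exp_smul x y)

end Analysis

/-! ### The Stein identity as a differential equation along dilations. -/

section SteinEquation

set_option linter.unusedSectionVars false

open scoped FourierTransform ContDiff
open Complex (I)

variable {V : Type*} [NormedAddCommGroup V] [InnerProductSpace ℝ V] [MeasurableSpace V]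

/-- The Stein identity for complex-valued Schwartz functions. -/
def SteinIdentity (μ : Measure V) (b : V) (κ : Measure V) : Prop :=
  ∀ f : 𝓢(V, ℂ), ∫ x, fderiv ℝ f x x ∂μ
    = ∫ x, fderiv ℝ f x b ∂μ + ∫ x, ∫ u, (f (x + u) - f x) ∂κ ∂μ

variable [BorelSpace V] [FiniteDimensional ℝ V] {κ μ : Measure V} {b : V}

/-- Testing with the dilate `f (s • ·)`, again Schwartz, carries the information from `y = 0` to
every point of the ray. -/
theorem SteinIdentity.smul (h : SteinIdentity μ b κ) (f : 𝓢(V, ℂ)) {s : ℝ} (hs : s ≠ 0) :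
    ∫ x, fderiv ℝ f (s • x) (s • x) ∂μ
      = ∫ x, fderiv ℝ f (s • x) (s • b) ∂μ
        + ∫ x, ∫ u, (f (s • (x + u)) - f (s • x)) ∂κ ∂μ := by
  let e : V ≃L[ℝ] V := ContinuousLinearEquiv.smulLeft (Units.mk0 s hs)
  have he : ∀ x, e x = s • x := fun x => rfl
  have h2 := h (SchwartzMap.compCLMOfContinuousLinearEquiv ℂ e f)
  simpa [e.comp_right_fderiv, he] using h2

theorem SteinIdentity.hasDerivAt [IsProbabilityMeasure μ] [SFinite κ] (h : SteinIdentity μ b κ)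
    (hκ : Integrable (fun u => min 1 ‖u‖) κ) (g : 𝓢(V, ℂ)) (y : ℝ) :
    HasDerivAt (fun y : ℝ => ∫ ξ, g ξ * charFun μ ((Real.exp y * -(2 * Real.pi)) • ξ))
      (∫ ξ, g ξ * (charFun μ ((Real.exp y * -(2 * Real.pi)) • ξ)
        * steinSymbol b κ ((Real.exp y * -(2 * Real.pi)) • ξ))) y := by
  have := hasDerivAt_integral_exp_smul (μ := μ) (𝓕 g : 𝓢(V, ℂ)) y
  rw [h.smul _ (Real.exp_pos y).ne', stein_rhs_fourier hκ] at this
  simpa only [stein_lhs_fourier] using this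

theorem integrable_prod_mul_charFun_mul_steinSymbol [IsProbabilityMeasure μ]
    (hκ : Integrable (fun u => min 1 ‖u‖) κ) (b : V) (g : 𝓢(V, ℂ)) (c r t : ℝ) :
    Integrable (fun p : ℝ × V => g p.2 * (charFun μ ((Real.exp p.1 * c) • p.2)
        * steinSymbol b κ ((Real.exp p.1 * c) • p.2)))
      ((volume.restrict (Ioc r t)).prod volume) := by
  set A := 2 * ∫ u, min 1 ‖u‖ ∂κ
  -- The slope of the linear bound grows with `exp y`; on `Ioc r t` it is largest at `t`.
  set B := (Real.exp t * |c|) * ((∫ u, min 1 ‖u‖ ∂κ) + ‖b‖)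
  have hI : 0 ≤ ∫ u, min 1 ‖u‖ ∂κ := integral_nonneg fun u => by positivity
  have hcont := continuous_charFun_mul_steinSymbol (μ := μ) hκ b
  have hg := g.continuous
  have hb : Integrable (fun ξ => g ξ * ((A + B * ‖ξ‖ : ℝ) : ℂ)) :=
    integrable_mul_of_norm_le_linear g (A := A) (B := B) (by fun_prop) fun ξ => by
      rw [Complex.norm_real, Real.norm_of_nonneg (by positivity)]
  have hb' := hb.norm.comp_snd (volume.restrict (Ioc r t))
  refine hb'.mono' (Continuous.aestronglyMeasurable ?_) ?_
  · exact (hg.comp continuous_snd).mul (hcont.comp (by fun_prop :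
      Continuous fun p : ℝ × V => (Real.exp p.1 * c) • p.2))
  · have hae : ∀ᵐ p ∂((volume.restrict (Ioc r t)).prod (volume : Measure V)), p.1 ∈ Ioc r t :=
      Measure.quasiMeasurePreserving_fst.ae (ae_restrict_mem measurableSet_Ioc)
    filter_upwards [hae] with p hp
    rw [norm_mul (g p.2), norm_mul (g p.2), Complex.norm_real, Real.norm_of_nonneg (r := A + _)
      (by positivity)]
    gcongr
    refine (norm_charFun_mul_steinSymbol_le hκ b _ p.2).trans ?_
    simp only [abs_mul, Real.abs_exp, A, B]
    gcongr
    exact hp.2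

/-- The weak equation is integrated in `y` first. The resulting defect `D` is continuous in `ξ` and
orthogonal to all test functions, hence zero everywhere; no differentiability of `charFun μ` is
presupposed. -/
theorem SteinIdentity.charFun_sub [IsProbabilityMeasure μ] [SFinite κ] (h : SteinIdentity μ b κ)
    (hκ : Integrable (fun u => min 1 ‖u‖) κ) {r t : ℝ} (hrt : r ≤ t) (ξ : V) :
    charFun μ (Real.exp t • ξ) - charFun μ (Real.exp r • ξ)
      = ∫ y in r..t, charFun μ (Real.exp y • ξ) * steinSymbol b κ (Real.exp y • ξ) := by
  set c := -(2 * Real.pi) with hc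
  have hc0 : c ≠ 0 := by simp [hc, Real.pi_ne_zero]
  have hcont := continuous_charFun_mul_steinSymbol (μ := μ) hκ b
  have hψ : Continuous (charFun μ) := continuous_charFun
  let D : V → ℂ := fun ξ => charFun μ ((Real.exp t * c) • ξ) - charFun μ ((Real.exp r * c) • ξ)
    - ∫ y in r..t, charFun μ ((Real.exp y * c) • ξ) * steinSymbol b κ ((Real.exp y * c) • ξ)
  have hcont2 : Continuous (Function.uncurry fun (ξ : V) (y : ℝ) =>
      charFun μ ((Real.exp y * c) • ξ) * steinSymbol b κ ((Real.exp y * c) • ξ)) :=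
    hcont.comp (by fun_prop : Continuous fun p : V × ℝ => (Real.exp p.2 * c) • p.1)
  have hDc2 : Continuous fun ξ : V => ∫ y in r..t,
      charFun μ ((Real.exp y * c) • ξ) * steinSymbol b κ ((Real.exp y * c) • ξ) :=
    intervalIntegral.continuous_parametric_intervalIntegral_of_continuous' hcont2 r t
  have hD : Continuous D := by fun_prop
  have hint : ∀ (g : 𝓢(V, ℂ)) (s : ℝ), Integrable fun ξ => g ξ * charFun μ (s • ξ) := fun g s =>
    integrable_mul_of_norm_le_linear g (A := 1) (B := 0) (by fun_prop)
      fun ξ => by simpa using norm_charFun_le_one _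
  have hzero : ∀ᵐ ξ, D ξ = 0 := by
    refine ae_eq_zero_of_integral_contDiff_smul_eq_zero hD.locallyIntegrable fun g hg hgs => ?_
    let G : 𝓢(V, ℂ) := HasCompactSupport.toSchwartzMap (f := fun x => (g x : ℂ))
      (hgs.comp_left Complex.ofReal_zero) (Complex.ofRealCLM.contDiff.comp hg)
    have hG : ∀ ξ, (g ξ • D ξ : ℂ) = G ξ * D ξ := fun ξ => by
      rw [Complex.real_smul]
      rfl
    have hprod := integrable_prod_mul_charFun_mul_steinSymbol (μ := μ) hκ b G c r t
    have hftc := intervalIntegral.integral_eq_sub_of_hasDerivAt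
      (fun y _ => h.hasDerivAt hκ G y) (a := r) (b := t)
      ((intervalIntegrable_iff_integrableOn_Ioc_of_le hrt).2 hprod.integral_prod_left)
    rw [intervalIntegral.integral_of_le hrt, integral_integral_swap hprod] at hftc
    have hint2 := hprod.integral_prod_right
    simp only [integral_const_mul] at hftc hint2
    refine (integral_congr_ae (ae_of_all _ hG)).trans ?_
    simp only [D, mul_sub, intervalIntegral.integral_of_le hrt]
    rw [integral_sub _ hint2, integral_sub (hint G _) (hint G _), hftc, sub_self]
    exact (hint G _).sub (hint G _)
  have hall : D = fun _ => 0 := (hD.ae_eq_iff_eq volume continuous_const).1 hzero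
  -- Evaluation at `c⁻¹ • ξ` undoes the Fourier normalization.
  have := congrFun hall (c⁻¹ • ξ)
  simp only [D, smul_smul, mul_assoc, mul_inv_cancel₀ hc0, mul_one] at this
  exact sub_eq_zero.1 this

theorem SteinIdentity.hasDerivAt_charFun [IsProbabilityMeasure μ] [SFinite κ]
    (h : SteinIdentity μ b κ) (hκ : Integrable (fun u => min 1 ‖u‖) κ) (ξ : V) (y : ℝ) :
    HasDerivAt (fun y : ℝ => charFun μ (Real.exp y • ξ))
      (charFun μ (Real.exp y • ξ) * steinSymbol b κ (Real.exp y • ξ)) y := by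
  have hcont : Continuous fun y : ℝ =>
      charFun μ (Real.exp y • ξ) * steinSymbol b κ (Real.exp y • ξ) :=
    (continuous_charFun_mul_steinSymbol (μ := μ) hκ b).comp (by fun_prop)
  -- The integrated equation is available for ordered endpoints only; the base point `y - 1` lies to
  -- the left of a whole neighbourhood of `y`.
  have h1 := (hcont.integral_hasStrictDerivAt (y - 1) y).hasDerivAt
  refine (h1.const_add (charFun μ (Real.exp (y - 1) • ξ))).congr_of_eventuallyEq ?_
  filter_upwards [lt_mem_nhds (sub_one_lt y)] with z hz
  rw [← h.charFun_sub hκ hz.le, add_sub_cancel]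

/-- The Stein identity characterizes the law whose characteristic function is `exp Ψ`, if `Ψ` is a
primitive of the symbol along dilations. -/
theorem steinIdentity_iff_charFun_eq [IsProbabilityMeasure μ] [SFinite κ]
    (hκ : Integrable (fun u => min 1 ‖u‖) κ) {Ψ : V → ℂ} (hΨc : ContinuousAt Ψ 0) (hΨ0 : Ψ 0 = 0)
    (hΨ : ∀ ξ y, HasDerivAt (fun y : ℝ => Ψ (Real.exp y • ξ))
      (steinSymbol b κ (Real.exp y • ξ)) y) :
    SteinIdentity μ b κ ↔ ∀ ξ, charFun μ ξ = Complex.exp (Ψ ξ) := by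
  constructor
  · intro h ξ
    -- Integrating factor: `w` is constant, and `y → -∞` identifies the constant through `charFun μ
    -- 0 = 1` and `Ψ 0 = 0`.
    let w : ℝ → ℂ := fun y => charFun μ (Real.exp y • ξ) * Complex.exp (-Ψ (Real.exp y • ξ))
    have hw : ∀ y, HasDerivAt w 0 y := fun y => by
      refine ((h.hasDerivAt_charFun hκ ξ y).mul (hΨ ξ y).neg.cexp).congr_deriv ?_
      ring
    have hconst : ∀ y, w y = w 0 := fun y =>
      is_const_of_deriv_eq_zero (fun y => (hw y).differentiableAt) (fun y => (hw y).deriv) y 0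
    have hexp : Tendsto (fun y : ℝ => Real.exp y • ξ) atBot (𝓝 0) := by
      simpa using Real.tendsto_exp_atBot.smul_const ξ
    have hlim : Tendsto w atBot (𝓝 (charFun μ 0 * Complex.exp (-Ψ 0))) :=
      ((continuous_charFun.tendsto 0).comp hexp).mul
        ((hΨc.tendsto.comp hexp).neg.cexp)
    have hw0 : w 0 = 1 := by
      rw [hΨ0] at hlim
      have : w = fun _ => w 0 := funext hconst
      rw [this] at hlim
      have := tendsto_nhds_unique hlim tendsto_const_nhds
      simpa using this.symm
    simp only [w, Real.exp_zero, one_smul] at hw0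
    rw [Complex.exp_neg] at hw0
    exact (mul_inv_eq_one₀ (Complex.exp_ne_zero _)).1 hw0
  · intro h f
    obtain ⟨g, rfl⟩ : ∃ g : 𝓢(V, ℂ), (𝓕 g : 𝓢(V, ℂ)) = f :=
      ⟨𝓕⁻ f, FourierTransform.fourier_fourierInv_eq f⟩
    set c := -(2 * Real.pi) with hc
    have hψ : Continuous (charFun μ) := continuous_charFun
    have hcont := continuous_charFun_mul_steinSymbol (μ := μ) hκ b
    have hder : ∀ ξ y, HasDerivAt (fun y : ℝ => charFun μ ((Real.exp y * c) • ξ))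
        (charFun μ ((Real.exp y * c) • ξ) * steinSymbol b κ ((Real.exp y * c) • ξ)) y :=
      fun ξ y => by
        simp only [h, mul_smul]
        exact (hΨ (c • ξ) y).cexp
    have hI : 0 ≤ ∫ u, min 1 ‖u‖ ∂κ := integral_nonneg fun u => by positivity
    set A := 2 * ∫ u, min 1 ‖u‖ ∂κ
    -- Only the derivative at `y = 0` is needed, so domination is required just on `Iio 1`, where
    -- `exp y ≤ exp 1`.
    set B := (Real.exp 1 * |c|) * ((∫ u, min 1 ‖u‖ ∂κ) + ‖b‖)
    have hb : Integrable (fun ξ => g ξ * ((A + B * ‖ξ‖ : ℝ) : ℂ)) :=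
      integrable_mul_of_norm_le_linear g (A := A) (B := B) (by fun_prop) fun ξ => by
        rw [Complex.norm_real, Real.norm_of_nonneg (by positivity)]
    have hg := g.continuous
    have key := (hasDerivAt_integral_of_dominated_loc_of_deriv_le (μ := (volume : Measure V))
      (s := Iio (1 : ℝ)) (x₀ := 0) (F := fun y ξ => g ξ * charFun μ ((Real.exp y * c) • ξ))
      (F' := fun y ξ => g ξ * (charFun μ ((Real.exp y * c) • ξ)
        * steinSymbol b κ ((Real.exp y * c) • ξ)))
      (bound := fun ξ => ‖g ξ * ((A + B * ‖ξ‖ : ℝ) : ℂ)‖)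
      (Iio_mem_nhds one_pos)
      (Eventually.of_forall fun y => Continuous.aestronglyMeasurable (by fun_prop))
      (integrable_mul_of_norm_le_linear g (A := 1) (B := 0) (by fun_prop)
        fun ξ => by simpa using norm_charFun_le_one _)
      (Continuous.aestronglyMeasurable (hg.mul (hcont.comp (continuous_const_smul _))))
      (ae_of_all _ fun ξ y hy => ?_) hb.norm
      (ae_of_all _ fun ξ y _ => (hder ξ y).const_mul _)).2
    · have h1 := hasDerivAt_integral_exp_smul (μ := μ) (𝓕 g : 𝓢(V, ℂ)) 0
      simp only [stein_lhs_fourier] at h1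
      -- The same function of `y` is differentiated under the `μ`-integral and under the
      -- `ξ`-integral; equating both values at 0 is the identity.
      have h2 := h1.unique key
      rw [← stein_rhs_fourier hκ] at h2
      simpa using h2
    · rw [norm_mul (g ξ), norm_mul (g ξ), Complex.norm_real, Real.norm_of_nonneg (r := A + _)
        (by positivity)]
      gcongr
      refine (norm_charFun_mul_steinSymbol_le hκ b _ ξ).trans ?_
      simp only [abs_mul, Real.abs_exp, A, B]
      gcongr
      exact (mem_Iio.1 hy).le

end SteinEquation

/-! ### Passage between real and complex test functions. -/

section SteinDefect

set_option linter.unusedSectionVars false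

variable {V W W' : Type*} [NormedAddCommGroup V] [InnerProductSpace ℝ V] [MeasurableSpace V]
  [NormedAddCommGroup W] [NormedSpace ℝ W] [NormedAddCommGroup W'] [NormedSpace ℝ W']

/-- The difference of the two sides of the Stein identity. -/
noncomputable def steinDefect (μ : Measure V) (b : V) (κ : Measure V) (f : 𝓢(V, W)) : W :=
  ∫ x, fderiv ℝ f x x ∂μ - (∫ x, fderiv ℝ f x b ∂μ + ∫ x, ∫ u, (f (x + u) - f x) ∂κ ∂μ)

variable [BorelSpace V] [FiniteDimensional ℝ V] {κ μ : Measure V} {b : V}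

theorem continuous_fderiv_schwartz (f : 𝓢(V, W)) : Continuous (fderiv ℝ f) :=
  (f.smooth 1).continuous_fderiv one_ne_zero

theorem exists_norm_fderiv_le (f : 𝓢(V, W)) : ∃ C, 0 ≤ C ∧ ∀ x, ‖fderiv ℝ f x‖ ≤ C := by
  obtain ⟨C, hC0, hC⟩ := f.decay 0 1
  exact ⟨C, hC0.le, fun x => by simpa [norm_iteratedFDeriv_one] using hC x⟩

theorem exists_norm_sub_le_min (f : 𝓢(V, W)) :
    ∃ C, ∀ x u, ‖f (x + u) - f x‖ ≤ C * min 1 ‖u‖ := by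
  obtain ⟨C, hC0, hC⟩ := exists_norm_fderiv_le f
  obtain ⟨B, hB⟩ : ∃ B, ∀ x, ‖f x‖ ≤ B := ⟨_, f.norm_le_seminorm ℝ⟩
  have hB0 : 0 ≤ B := (norm_nonneg _).trans (hB 0)
  refine ⟨C + 2 * B, fun x u => ?_⟩
  rcases le_total 1 ‖u‖ with h | h
  · rw [min_eq_left h]
    have := norm_sub_le (f (x + u)) (f x)
    linarith [hB x, hB (x + u)]
  · rw [min_eq_right h]
    have := convex_univ.norm_image_sub_le_of_norm_fderiv_le (𝕜 := ℝ)
      (fun y _ => f.differentiableAt) (fun y _ => hC y) (mem_univ x) (mem_univ (x + u))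
    rw [add_sub_cancel_left] at this
    nlinarith [norm_nonneg u]

theorem integrable_fderiv_apply_self [IsFiniteMeasure μ] (f : 𝓢(V, W)) :
    Integrable (fun x => fderiv ℝ f x x) μ := by
  obtain ⟨C, hC⟩ := exists_norm_fderiv_apply_self_le f
  have := continuous_fderiv_schwartz f
  exact Integrable.of_bound (Continuous.aestronglyMeasurable (by fun_prop)) C (ae_of_all _ hC)

theorem integrable_fderiv_apply [IsFiniteMeasure μ] (f : 𝓢(V, W)) (b : V) :
    Integrable (fun x => fderiv ℝ f x b) μ := by
  obtain ⟨C, -, hC⟩ := exists_norm_fderiv_le f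
  have := continuous_fderiv_schwartz f
  exact Integrable.of_bound (Continuous.aestronglyMeasurable (by fun_prop)) (C * ‖b‖)
    (ae_of_all _ fun x => (fderiv ℝ f x).le_of_opNorm_le (hC x) b)

theorem integrable_schwartz_sub (hκ : Integrable (fun u => min 1 ‖u‖) κ) (f : 𝓢(V, W)) (x : V) :
    Integrable (fun u => f (x + u) - f x) κ := by
  obtain ⟨C, hC⟩ := exists_norm_sub_le_min f
  have := f.continuous
  exact (hκ.const_mul C).mono' (Continuous.aestronglyMeasurable (by fun_prop))
    (ae_of_all _ (hC x))

theorem continuous_integral_schwartz_sub (hκ : Integrable (fun u => min 1 ‖u‖) κ)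
    (f : 𝓢(V, W)) : Continuous fun x => ∫ u, (f (x + u) - f x) ∂κ := by
  obtain ⟨C, hC⟩ := exists_norm_sub_le_min f
  have := f.continuous
  exact continuous_of_dominated (fun x => (integrable_schwartz_sub hκ f x).aestronglyMeasurable)
    (fun x => ae_of_all _ (hC x)) (hκ.const_mul C) (ae_of_all _ fun u => by fun_prop)

theorem integrable_integral_schwartz_sub [IsFiniteMeasure μ]
    (hκ : Integrable (fun u => min 1 ‖u‖) κ) (f : 𝓢(V, W)) :
    Integrable (fun x => ∫ u, (f (x + u) - f x) ∂κ) μ := by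
  obtain ⟨C, hC⟩ := exists_norm_sub_le_min f
  exact Integrable.of_bound (continuous_integral_schwartz_sub hκ f).aestronglyMeasurable
    (∫ u, C * min 1 ‖u‖ ∂κ)
    (ae_of_all _ fun x => norm_integral_le_of_norm_le (hκ.const_mul C) (ae_of_all _ (hC x)))

/-- Bounded linear maps commute with derivatives and Bochner integrals. Real part, imaginary part
and the inclusion of `ℝ` in `ℂ` then transfer the identity both ways. -/
theorem steinDefect_postcompCLM [CompleteSpace W] [CompleteSpace W'] [IsFiniteMeasure μ]
    (hκ : Integrable (fun u => min 1 ‖u‖) κ) (T : W →L[ℝ] W') (f : 𝓢(V, W)) :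
    steinDefect μ b κ (f.postcompCLM T) = T (steinDefect μ b κ f) := by
  have hd : ∀ x v, fderiv ℝ (f.postcompCLM T) x v = T (fderiv ℝ f x v) := fun x v =>
    congrArg (· v) (T.hasFDerivAt.comp x f.differentiableAt.hasFDerivAt).fderiv
  simp only [steinDefect, hd, SchwartzMap.postcompCLM_apply, ← map_sub]
  rw [T.integral_comp_comm (integrable_fderiv_apply_self f),
    T.integral_comp_comm (integrable_fderiv_apply f b)]
  simp only [fun x => T.integral_comp_comm (integrable_schwartz_sub hκ f x)]
  rw [T.integral_comp_comm (integrable_integral_schwartz_sub hκ f), map_sub, map_add]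

theorem forall_steinDefect_real_eq_zero_iff [IsFiniteMeasure μ]
    (hκ : Integrable (fun u => min 1 ‖u‖) κ) :
    (∀ f : 𝓢(V, ℝ), steinDefect μ b κ f = 0) ↔ SteinIdentity μ b κ := by
  constructor
  · intro h f
    refine sub_eq_zero.1 (Complex.ext ?_ ?_ : steinDefect μ b κ f = 0)
    · exact (steinDefect_postcompCLM hκ Complex.reCLM f).symm.trans (h _)
    · exact (steinDefect_postcompCLM hκ Complex.imCLM f).symm.trans (h _)
  · intro h f
    have := (steinDefect_postcompCLM (b := b) (μ := μ) hκ Complex.ofRealCLM f).symm.trans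
      (sub_eq_zero.2 (h _))
    exact Complex.ofReal_eq_zero.1 this

end SteinDefect

/-! ### The jump exponent of a measure swept out by contractions. -/

section Dilation

open Complex (I)

variable {V : Type*} [NormedAddCommGroup V] [InnerProductSpace ℝ V] [MeasurableSpace V]
  [BorelSpace V] [FiniteDimensional ℝ V]

/-- Pushing `e^z` onto `ξ` and translating `z` by `y` turns the exponent of `ν` at `e^y ξ` into an
integral over `Iic y`; the fundamental theorem of calculus gives the derivative. -/
theorem hasDerivAt_jumpExponent_exp_smul {κ ν : Measure V} [SFinite κ]
    (hκ : Integrable (fun u => min 1 ‖u‖) κ) (hν : Integrable (fun u => min 1 ‖u‖) ν)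
    (h : ν = (κ.prod (volume.restrict (Iic 0))).map fun p : V × ℝ => Real.exp p.2 • p.1)
    (ξ : V) (y : ℝ) :
    HasDerivAt (fun y : ℝ => jumpExponent ν (Real.exp y • ξ))
      (jumpExponent κ (Real.exp y • ξ)) y := by
  have hm : Measurable fun p : V × ℝ => Real.exp p.2 • p.1 := by fun_prop
  have hc : ∀ ξ : V, Continuous fun u : V => Complex.exp ((⟪u, ξ⟫ : ℝ) * I) - 1 := fun ξ => by
    fun_prop
  have hinner : ∀ (ξ u : V) (z : ℝ), (⟪Real.exp z • u, ξ⟫ : ℝ) = ⟪u, Real.exp z • ξ⟫ :=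
    fun ξ u z => by rw [inner_smul_left, inner_smul_right]; rfl
  have hprod : ∀ ξ : V, Integrable
      (fun p : V × ℝ => Complex.exp ((⟪p.1, Real.exp p.2 • ξ⟫ : ℝ) * I) - 1)
      (κ.prod (volume.restrict (Iic 0))) := fun ξ => by
    have := integrable_cexp_sub_one hν ξ
    rw [h, integrable_map_measure (hc ξ).aestronglyMeasurable hm.aemeasurable] at this
    simpa only [Function.comp_def, hinner] using this
  have hon : ∀ ξ : V, IntegrableOn (fun z : ℝ => jumpExponent κ (Real.exp z • ξ)) (Iic 0) :=
    fun ξ => (hprod ξ).integral_prod_right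
  have heq : ∀ ξ : V, jumpExponent ν ξ = ∫ z in Iic 0, jumpExponent κ (Real.exp z • ξ) :=
    fun ξ => by
      rw [jumpExponent, h, integral_map hm.aemeasurable (hc ξ).aestronglyMeasurable]
      simp only [hinner]
      rw [integral_prod_symm _ (hprod ξ)]
      rfl
  have hcont : Continuous fun z : ℝ => jumpExponent κ (Real.exp z • ξ) :=
    (continuous_jumpExponent hκ).comp (by fun_prop)
  have hpre : ∀ y : ℝ, (fun z => z + y) ⁻¹' Iic y = Iic 0 := fun y => by
    ext z
    simp
  -- Integrability up to `y` is integrability up to 0 for the frequency `exp y • ξ`, translated.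
  have hon' : ∀ y, IntegrableOn (fun z : ℝ => jumpExponent κ (Real.exp z • ξ)) (Iic y) :=
    fun y => by
      have := hon (Real.exp y • ξ)
      simp only [smul_smul, ← Real.exp_add] at this
      rw [← hpre y] at this
      exact ((measurePreserving_add_right volume y).integrableOn_comp_preimage
        (measurableEmbedding_addRight y)).1 this
  have hfun : ∀ y : ℝ, jumpExponent ν (Real.exp y • ξ)
      = (∫ z in Iic 0, jumpExponent κ (Real.exp z • ξ))
        + ∫ z in (0 : ℝ)..y, jumpExponent κ (Real.exp z • ξ) := fun y => by
    rw [← intervalIntegral.integral_Iic_sub_Iic (hon' 0) (hon' y), add_sub_cancel, heq]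
    simp only [smul_smul, ← Real.exp_add]
    rw [← hpre y]
    exact (measurePreserving_add_right volume y).setIntegral_preimage_emb
      (measurableEmbedding_addRight y) (fun z => jumpExponent κ (Real.exp z • ξ)) _
  rw [funext hfun]
  exact ((hcont.integral_hasStrictDerivAt 0 y).hasDerivAt).const_add _

end Dilation

/-! ### The radial disintegration of the Lévy measure through `-dk`. -/

section Polar

theorem stieltjesFunction_measure_Ici {g : ℝ → ℝ} (hg : AntitoneOn g (Ioi 0))
    (hc : ContinuousOn g (Ioi 0)) (ht : Tendsto g atTop (𝓝 0)) (v : ℝ) :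
    (monotone_neg_comp_exp hg).stieltjesFunction.measure (Ici v)
      = ENNReal.ofReal (g (Real.exp v)) := by
  have hcont : Continuous fun t : ℝ => -g (Real.exp t) :=
    (hc.comp_continuous Real.continuous_exp fun t => Real.exp_pos t).neg
  have hr : ⇑(monotone_neg_comp_exp hg).stieltjesFunction = fun t => -g (Real.exp t) :=
    funext fun t => (monotone_neg_comp_exp hg).continuousWithinAt_Ioi_iff_rightLim_eq.1
      hcont.continuousAt.continuousWithinAt
  have hl : Function.leftLim (fun t => -g (Real.exp t)) v = -g (Real.exp v) :=
    (monotone_neg_comp_exp hg).continuousWithinAt_Iio_iff_leftLim_eq.1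
      hcont.continuousAt.continuousWithinAt
  -- The limit `l = 0` at infinity is the vanishing of `g` there; without it a constant would
  -- remain.
  rw [StieltjesFunction.measure_Ici (l := 0), hr, hl]
  · simp
  · rw [hr]
    simpa using (ht.comp Real.tendsto_exp_atTop).neg

theorem radialDensity_apply (g : ℝ → ℝ) {B : Set ℝ} (hB : MeasurableSet B) :
    radialDensity g B
      = ∫⁻ v : ℝ, (Real.exp ⁻¹' B).indicator (fun v => ENNReal.ofReal (g (Real.exp v))) v := by
  rw [radialDensity, withDensity_apply _ hB, ← lintegral_indicator hB, ← Real.range_exp,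
    ← image_univ, lintegral_image_eq_lintegral_abs_deriv_mul MeasurableSet.univ
      (fun x _ => (Real.hasDerivAt_exp x).hasDerivWithinAt) Real.exp_injective.injOn,
    setLIntegral_univ]
  refine lintegral_congr fun v => ?_
  by_cases hv : Real.exp v ∈ B
  · rw [indicator_of_mem hv, indicator_of_mem (by exact hv), Real.abs_exp,
      ← ENNReal.ofReal_mul (Real.exp_pos v).le, mul_div_cancel₀ _ (Real.exp_pos v).ne']
  · rw [indicator_of_notMem hv, indicator_of_notMem (by exact hv), mul_zero]

/-- In logarithmic coordinates this is Tonelli on `{(w, v) | v ≤ w, exp v ∈ B}`: the slice at fixed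
`v` has Stieltjes mass `g (exp v)`, the density of `g(r) dr / r` with respect to `dv`. -/
theorem lintegral_negStieltjes_dilation {g : ℝ → ℝ} (hg : AntitoneOn g (Ioi 0))
    (hc : ContinuousOn g (Ioi 0)) (ht : Tendsto g atTop (𝓝 0)) {B : Set ℝ}
    (hB : MeasurableSet B) :
    ∫⁻ r, volume.restrict (Iic 0) {z : ℝ | Real.exp z * r ∈ B} ∂(negStieltjes g hg)
      = radialDensity g B := by
  set m := (monotone_neg_comp_exp hg).stieltjesFunction.measure
  have hS : MeasurableSet {p : ℝ × ℝ | Real.exp p.2 * p.1 ∈ B} :=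
    (by fun_prop : Measurable fun p : ℝ × ℝ => Real.exp p.2 * p.1) hB
  have hmeas : Measurable fun r : ℝ => volume.restrict (Iic 0) {z : ℝ | Real.exp z * r ∈ B} :=
    measurable_measure_prodMk_left hS
  have hB' : MeasurableSet (Real.exp ⁻¹' B) := Real.measurable_exp hB
  have hT : MeasurableSet {p : ℝ × ℝ | p.2 ≤ p.1 ∧ Real.exp p.2 ∈ B} :=
    (measurableSet_le measurable_snd measurable_fst).inter (measurable_snd hB')
  have h1 : ∀ w : ℝ, volume.restrict (Iic 0) {z : ℝ | Real.exp z * Real.exp w ∈ B}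
      = volume {v : ℝ | v ≤ w ∧ Real.exp v ∈ B} := fun w => by
    have hw : MeasurableSet {z : ℝ | Real.exp z * Real.exp w ∈ B} :=
      (by fun_prop : Measurable fun z : ℝ => Real.exp z * Real.exp w) hB
    rw [Measure.restrict_apply hw,
      ← measure_preimage_add_right volume w {v : ℝ | v ≤ w ∧ Real.exp v ∈ B}]
    congr 1
    ext z
    simp [Real.exp_add, and_comm]
  rw [negStieltjes, lintegral_map hmeas Real.measurable_exp, radialDensity_apply g hB]
  simp only [h1]
  have h2 := (Measure.prod_apply (μ := m) (ν := volume) hT).symm.trans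
    (Measure.prod_apply_symm (μ := m) (ν := volume) hT)
  refine h2.trans (lintegral_congr fun v => ?_)
  by_cases hv : Real.exp v ∈ B
  · rw [indicator_of_mem (by exact hv), ← stieltjesFunction_measure_Ici hg hc ht]
    congr 1
    ext w
    simp [hv]
  · rw [indicator_of_notMem (by exact hv)]
    simp [hv]

variable {d : ℕ} {σ : Measure (USphere d)} {k : USphere d → ℝ → ℝ}

theorem aemeasurable_map_negStieltjes (ha : ∀ x, AntitoneOn (k x) (Ioi 0))
    (hc : ∀ x, ContinuousOn (k x) (Ioi 0)) (hm : ∀ r > 0, Measurable fun x => k x r) :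
    AEMeasurable (fun x => (negStieltjes (k x) (ha x)).map
      fun r : ℝ => r • (x : EuclideanSpace ℝ (Fin d))) σ := by
  refine (measurable_map_smul (fun a b h h' => ?_) (fun x a b h h' => ?_)
    fun x => negStieltjes_Iic_zero _ _).aemeasurable
  · simp only [negStieltjes_Ioc _ (ha _) (hc _) h h']
    exact ((hm a h).sub (hm b h')).ennreal_ofReal
  · rw [negStieltjes_Ioc _ (ha _) (hc _) h h']
    exact ENNReal.ofReal_lt_top

theorem polarMeasure_radialDensity_eq_map_prod (ha : ∀ x, AntitoneOn (k x) (Ioi 0))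
    (hc : ∀ x, ContinuousOn (k x) (Ioi 0)) (hm : ∀ r > 0, Measurable fun x => k x r)
    (ht : ∀ x, Tendsto (k x) atTop (𝓝 0)) :
    polarMeasure σ (fun x => radialDensity (k x))
      = ((polarMeasure σ fun x => negStieltjes (k x) (ha x)).prod (volume.restrict (Iic 0))).map
          fun p : EuclideanSpace ℝ (Fin d) × ℝ => Real.exp p.2 • p.1 := by
  have hsm : Measurable fun p : EuclideanSpace ℝ (Fin d) × ℝ => Real.exp p.2 • p.1 := by fun_prop
  ext B hB
  rw [polarMeasure_radialDensity_apply σ ha hc hm hB, Measure.map_apply hsm hB,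
    Measure.prod_apply (hsm hB), polarMeasure,
    Measure.lintegral_bind (aemeasurable_map_negStieltjes ha hc hm)
      (measurable_measure_prodMk_left (hsm hB)).aemeasurable]
  refine lintegral_congr fun x => ?_
  have hsx : Measurable fun r : ℝ => r • (x : EuclideanSpace ℝ (Fin d)) := by fun_prop
  rw [lintegral_map (measurable_measure_prodMk_left (hsm hB)) hsx,
    ← lintegral_negStieltjes_dilation (ha x) (hc x) (ht x)
      (B := {r | r • (x : EuclideanSpace ℝ (Fin d)) ∈ B}) (hsx hB)]
  simp only [mem_ofPred_eq, mul_smul]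
  rfl

theorem polarMeasure_negStieltjes_singleton_zero (ha : ∀ x, AntitoneOn (k x) (Ioi 0))
    (hc : ∀ x, ContinuousOn (k x) (Ioi 0)) (hm : ∀ r > 0, Measurable fun x => k x r) :
    polarMeasure σ (fun x => negStieltjes (k x) (ha x)) {0} = 0 := by
  rw [polarMeasure_negStieltjes_apply σ ha hc hm (measurableSet_singleton 0)]
  refine (lintegral_congr fun x => ?_).trans lintegral_zero
  refine measure_mono_null (fun r hr => ?_) (negStieltjes_Iic_zero (k x) (ha x))
  have hx : (x : EuclideanSpace ℝ (Fin d)) ≠ 0 := ne_zero_of_mem_unit_sphere x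
  exact ((smul_eq_zero.1 (mem_singleton_iff.1 hr)).resolve_right hx).le

end Polar

/-! ### Integrability and s-finiteness of jump measures. -/

section LevyMeasure

variable {V : Type*} [NormedAddCommGroup V] [MeasurableSpace V] [BorelSpace V] {κ : Measure V}

theorem integrable_min_one_norm (h : ∫⁻ u, ENNReal.ofReal (min 1 ‖u‖) ∂κ < ∞) :
    Integrable (fun u => min 1 ‖u‖) κ := by
  refine ⟨Measurable.aestronglyMeasurable (by fun_prop), ?_⟩
  rw [hasFiniteIntegral_iff_ofReal (ae_of_all _ fun u => by positivity)]
  exact h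

/-- Weighting `κ` by `min 1 ‖u‖` gives a finite measure, and the weight vanishes only at the null
point 0, so it can be divided out. Fubini for `κ` relies on this. -/
theorem sFinite_of_lintegral_min_one_norm (h0 : κ {0} = 0)
    (h : ∫⁻ u, ENNReal.ofReal (min 1 ‖u‖) ∂κ < ∞) : SFinite κ := by
  have hm : Measurable fun u : V => ENNReal.ofReal (min 1 ‖u‖) := by fun_prop
  have hne : ∀ᵐ u ∂κ, ENNReal.ofReal (min 1 ‖u‖) ≠ 0 := by
    filter_upwards [compl_mem_ae_iff.2 h0] with u hu
    simpa using hu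
  have := isFiniteMeasure_withDensity h.ne
  rw [← withDensity_inv_same hm hne (ae_of_all _ fun _ => ENNReal.ofReal_ne_top)]
  infer_instance

end LevyMeasure

/-! ### The Lévy–Khintchine exponent in the finite variation case. -/

section Triplet

open Complex (I)

variable {d : ℕ} {ν : Measure (EuclideanSpace ℝ (Fin d))}

theorem IsLevyMeasure.integrable_min_one_norm (hν : IsLevyMeasure ν)
    (hν1 : ∫⁻ u in Metric.closedBall (0 : EuclideanSpace ℝ (Fin d)) 1, ‖u‖ₑ ∂ν < ∞) :
    Integrable (fun u => min 1 ‖u‖) ν := by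
  refine SelfDec.integrable_min_one_norm ?_
  have hb : MeasurableSet (Metric.closedBall (0 : EuclideanSpace ℝ (Fin d)) 1) :=
    Metric.isClosed_closedBall.measurableSet
  rw [← lintegral_indicator hb] at hν1
  refine lt_of_le_of_lt (lintegral_mono fun u => ?_)
    ((lintegral_add_right _ (by fun_prop)).trans_lt
      (ENNReal.add_lt_top.2 ⟨hν1, hν.lintegral_lt_top⟩))
  by_cases hu : ‖u‖ ≤ 1
  · refine le_add_right ?_
    rw [indicator_of_mem (by simpa using hu), min_eq_right hu, ofReal_norm]
  · refine le_add_left (ENNReal.ofReal_le_ofReal ?_)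
    push Not at hu
    rw [min_eq_left hu.le, min_eq_left (by nlinarith)]

/-- The compensator is integrable on its own because small jumps have finite first moment, so it
moves into the drift. -/
theorem levyKhintchineExponent_zero_eq (hν : IsLevyMeasure ν)
    (hν1 : ∫⁻ u in Metric.closedBall (0 : EuclideanSpace ℝ (Fin d)) 1, ‖u‖ₑ ∂ν < ∞)
    (b ξ : EuclideanSpace ℝ (Fin d)) :
    levyKhintchineExponent b 0 ν ξ
      = (⟪b - ∫ u in Metric.closedBall (0 : EuclideanSpace ℝ (Fin d)) 1, u ∂ν, ξ⟫ : ℝ) * I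
        + jumpExponent ν ξ := by
  have hb : MeasurableSet (Metric.closedBall (0 : EuclideanSpace ℝ (Fin d)) 1) :=
    Metric.isClosed_closedBall.measurableSet
  have hid : IntegrableOn (fun u : EuclideanSpace ℝ (Fin d) => u) (Metric.closedBall 0 1) ν :=
    ⟨aestronglyMeasurable_id, hν1⟩
  have hin : IntegrableOn (fun u : EuclideanSpace ℝ (Fin d) => I * ((⟪ξ, u⟫ : ℝ) : ℂ))
      (Metric.closedBall 0 1) ν := ((hid.const_inner ξ).ofReal).const_mul I
  have hcomm : ∀ u, I * ((⟪ξ, u⟫ : ℝ) : ℂ) = (⟪u, ξ⟫ : ℝ) * I := fun u => by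
    rw [mul_comm, real_inner_comm]
  have hexp : Integrable (fun u => Complex.exp (I * ((⟪ξ, u⟫ : ℝ) : ℂ)) - 1) ν := by
    simp only [hcomm]
    exact integrable_cexp_sub_one (hν.integrable_min_one_norm hν1) ξ
  rw [levyKhintchineExponent, integral_sub hexp (hin.integrable_indicator hb),
    integral_indicator hb, integral_const_mul, integral_complex_ofReal, integral_inner hid]
  rw [inner_sub_left]
  simp only [hcomm, jumpExponent, map_zero, LinearMap.zero_apply, inner_zero_right,
    Complex.ofReal_zero, Complex.ofReal_sub]
  ring

theorem isSelfDecomposable_iff {μ : Measure (EuclideanSpace ℝ (Fin d))}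
    {b : EuclideanSpace ℝ (Fin d)} (hν : IsLevyMeasure ν) {σ : Measure (USphere d)}
    [IsFiniteMeasure σ] {k : USphere d → ℝ → ℝ}
    (hpolar : ν = polarMeasure σ fun x => radialDensity (k x))
    (hk_nonneg : ∀ x, ∀ r > 0, 0 ≤ k x r) (hk_anti : ∀ x, AntitoneOn (k x) (Ioi 0))
    (hk_cont_r : ∀ x, ContinuousOn (k x) (Ioi 0)) (hk_meas : ∀ r > 0, Measurable fun x => k x r) :
    IsSelfDecomposable μ b ν
      ↔ ∀ ξ, charFun μ ξ = Complex.exp (levyKhintchineExponent b 0 ν ξ) :=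
  ⟨fun h => h.isInfinitelyDivisible.charFun_eq, fun h =>
    ⟨⟨Matrix.PosSemidef.zero, hν, h⟩, σ, k, inferInstance, hk_nonneg, hk_anti,
      fun x _ hr => ((hk_cont_r x).continuousAt (Ioi_mem_nhds hr)).continuousWithinAt,
      hk_meas, hpolar⟩⟩

end Triplet

end SelfDec

/-! ### The characterization of the law of `X`. -/

theorem mainTheorem4 {d : ℕ} {Ω : Type*} [MeasurableSpace Ω] (P : Measure Ω)
    [IsProbabilityMeasure P] (X : Ω → EuclideanSpace ℝ (Fin d)) (hX : AEMeasurable X P)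
    (b : EuclideanSpace ℝ (Fin d)) (ν : Measure (EuclideanSpace ℝ (Fin d)))
    (hν : SelfDec.IsLevyMeasure ν)
    (hν1 : ∫⁻ u in Metric.closedBall (0 : EuclideanSpace ℝ (Fin d)) 1, ‖u‖ₑ ∂ν < ∞)
    (σ : Measure (SelfDec.USphere d)) [IsFiniteMeasure σ] (k : SelfDec.USphere d → ℝ → ℝ)
    (hpolar : ν = SelfDec.polarMeasure σ fun x => SelfDec.radialDensity (k x))
    (hk_nonneg : ∀ x, ∀ r > 0, 0 ≤ k x r)
    (hk_anti : ∀ x, AntitoneOn (k x) (Ioi 0))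
    (hk_cont_r : ∀ x, ContinuousOn (k x) (Ioi 0))
    (hk_cont_x : ∀ r > 0, Continuous fun x => k x r)
    (hk_zero : ∀ x, Tendsto (fun ε => ε * k x ε) (𝓝[>] 0) (𝓝 0))
    (hk_top : ∀ x, Tendsto (k x) atTop (𝓝 0))
    (hk_max : ∫⁻ r in Ioi (0 : ℝ),
      ENNReal.ofReal (min 1 r / r) * ⨆ x, ENNReal.ofReal (k x r) < ∞)
    (hk_var : ∀ (x : ℕ → SelfDec.USphere d) (x₀ : SelfDec.USphere d),
      Tendsto x atTop (𝓝 x₀) → ∀ a > 0,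
        Tendsto (fun n => ⨆ R : ℝ, eVariationOn (fun r => k (x n) r - k x₀ r) (Icc a R))
          atTop (𝓝 0))
    (ν' : Measure (EuclideanSpace ℝ (Fin d)))
    (hν' : ν' = SelfDec.polarMeasure σ fun x => SelfDec.negStieltjes (k x) (hk_anti x))
    (hν'1 : ∫⁻ u, ENNReal.ofReal (min 1 ‖u‖) ∂ν' < ∞)
    (b₀ : EuclideanSpace ℝ (Fin d))
    (hb₀ : b₀ = b - ∫ u in Metric.closedBall (0 : EuclideanSpace ℝ (Fin d)) 1, u ∂ν) :
    (∀ f : 𝓢(EuclideanSpace ℝ (Fin d), ℝ),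
      ∫ ω, ⟪X ω, ∇ f (X ω)⟫ ∂P
        = ∫ ω, ⟪b₀, ∇ f (X ω)⟫ ∂P + ∫ ω, ∫ u, (f (X ω + u) - f (X ω)) ∂ν' ∂P)
    ↔ SelfDec.IsSelfDecomposable (P.map X) b ν := by

  have hk_meas : ∀ r > 0, Measurable fun x => k x r := fun r hr => (hk_cont_x r hr).measurable
  have hprob : IsProbabilityMeasure (P.map X) := Measure.isProbabilityMeasure_map hX
  have hν'0 : ν' {0} = 0 := by
    rw [hν']
    exact SelfDec.polarMeasure_negStieltjes_singleton_zero hk_anti hk_cont_r hk_meas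
  have hsf : SFinite ν' := SelfDec.sFinite_of_lintegral_min_one_norm hν'0 hν'1
  have hint' := SelfDec.integrable_min_one_norm hν'1
  have hint := hν.integrable_min_one_norm hν1
  have hdil := SelfDec.polarMeasure_radialDensity_eq_map_prod (σ := σ) hk_anti hk_cont_r hk_meas
    hk_top
  rw [← hpolar, ← hν'] at hdil
  have hgrad : ∀ (f : 𝓢(EuclideanSpace ℝ (Fin d), ℝ)) (v x : EuclideanSpace ℝ (Fin d)),
      (⟪v, ∇ f x⟫ : ℝ) = fderiv ℝ f x v := fun f v x => by
    rw [real_inner_comm, gradient, InnerProductSpace.toDual_symm_apply]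
  have hstein : (∀ f : 𝓢(EuclideanSpace ℝ (Fin d), ℝ), ∫ ω, ⟪X ω, ∇ f (X ω)⟫ ∂P
      = ∫ ω, ⟪b₀, ∇ f (X ω)⟫ ∂P + ∫ ω, ∫ u, (f (X ω + u) - f (X ω)) ∂ν' ∂P)
      ↔ SelfDec.SteinIdentity (P.map X) b₀ ν' := by
    rw [← SelfDec.forall_steinDefect_real_eq_zero_iff hint']
    refine forall_congr' fun f => ?_
    rw [SelfDec.steinDefect, sub_eq_zero,
      integral_map hX (SelfDec.integrable_fderiv_apply_self f).aestronglyMeasurable,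
      integral_map hX (SelfDec.integrable_fderiv_apply f b₀).aestronglyMeasurable,
      integral_map hX (SelfDec.integrable_integral_schwartz_sub hint' f).aestronglyMeasurable]
    simp only [hgrad]
  have hcont : Continuous fun ξ => (⟪b₀, ξ⟫ : ℝ) * Complex.I + SelfDec.jumpExponent ν ξ := by
    have := SelfDec.continuous_jumpExponent hint
    fun_prop
  rw [hstein, SelfDec.isSelfDecomposable_iff hν hpolar hk_nonneg hk_anti hk_cont_r hk_meas]
  simp only [SelfDec.levyKhintchineExponent_zero_eq hν hν1, ← hb₀]
  refine SelfDec.steinIdentity_iff_charFun_eq hint' hcont.continuousAt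
    (by simp [SelfDec.jumpExponent_zero]) fun ξ y => ?_
  -- The drift is linear in `ξ`, hence its own derivative along `y ↦ exp y • ξ`; only the jump part
  -- changes measure, from `ν` to `ν'`.
  refine HasDerivAt.add ?_ (SelfDec.hasDerivAt_jumpExponent_exp_smul hint' hint hdil ξ y)
  simp only [inner_smul_right]
  exact (((Real.hasDerivAt_exp y).mul_const _).ofReal_comp).mul_const Complex.I
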